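/- Conventions. A signature $\sigma=\mathrm{Rels}\uplus\mathrm{Cons}$ consists of a finite non-empty set $\mathrm{Rels}$ of relation symbols, each of arity at least $1$, and a finite (possibly empty) set $\mathrm{Cons}$ of constant symbols; there are no other function symbols. Its width $\mathrm{wd}(\sigma)$ is the maximum arity of a symbol in $\mathrm{Rels}$. Structures have non-empty domains and obey the standard name assumption: every constant symbol denotes itself, i.e. distinct constant symbols denote distinct elements. The unnamed domain of a structure is the set of its elements that are not denoted by a constant symbol. "Satisfiable" and "model" refer to such structures. For $k\in\mathbb N$, a $k$-type over $\sigma$ is a maximal consistent set of non-equality literals (relational atoms and negated relational atoms) over the symbols of $\sigma$ and the variables $x_1,\dots,x_k$; $\boldsymbol\tau^\sigma_k$ is the set of all $k$-types over $\sigma$. A sentence over $\sigma$ (first-order logic with equality) is a normal-form sentence of the guarded fragment (GF) if it is a finite conjunction of sentences of the three forms \[ \exists\bar x\,(\alpha(\bar x)\wedge\psi(\bar x)),\qquad \forall\bar x\,(\alpha(\bar x)\to\psi(\bar x)),\qquad \forall\bar x\,\bigl(\alpha(\bar x)\to\exists\bar y\,(\beta(\bar x,\bar y)\wedge\psi(\bar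 x,\bar y))\bigr), \] where $\bar x,\bar y$ are disjoint tuples of distinct variables, $\alpha,\beta$ are atomic formulas (equalities allowed), $\psi$ is quantifier-free, in the first two forms $\mathrm{fv}(\psi)\subseteq\mathrm{fv}(\alpha)=\bar x$, and in the third form $\mathrm{fv}(\alpha)=\bar x$ and $\mathrm{fv}(\psi)\cup\bar y\subseteq\mathrm{fv}(\beta)\subseteq\bar x\cup\bar y$. Proposition. There exists a constant $C>0$ such that for every signature $\sigma$ and every normal-form GF-sentence $\phi$ over $\sigma$ the following holds, where $w=\mathrm{wd}(\sigma)$: if $\phi$ is satisfiable, then $\phi$ has a finite model whose unnamed domain has size at most \[ C\cdot\frac{|\boldsymbol\tau^\sigma_{w}|}{|\boldsymbol\tau^\sigma_{w-1}|}\cdot\bigl(\ln|\boldsymbol\tau^\sigma_{w}|\bigr)^2 . \] -/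

import Mathlib

open scoped FirstOrder

universe u v w

namespace GuardedFragment

/-- A language is a *signature* (in the sense of the guarded fragment) if it consists of finitely
many relation symbols, at least one, all of positive arity, and of finitely many constant symbols,
and has no function symbols of positive arity. -/
structure IsSignature (L : FirstOrder.Language.{u, v}) : Prop where
  no_functions : ∀ n, IsEmpty (L.Functions (n + 1))
  finite_constants : Finite L.Constants
  finite_relations : Finite (Σ n, L.Relations n)
  nonempty_relations : Nonempty (Σ n, L.Relations n)
  arity_pos : IsEmpty (L.Relations 0)

/-- The *width* of a signature: the maximum arity of its relation symbols. -/
noncomputable def width (L : FirstOrder.Language.{u, v}) : ℕ :=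
  sSup {n | Nonempty (L.Relations n)}

section Types

variable (L : FirstOrder.Language.{u, v})

/-- The non-equality literals over the symbols of `L` and the variables `x_1, …, x_k`. -/
def Lit (k : ℕ) : Set (L.Formula (Fin k)) :=
  {γ | ∃ (n : ℕ) (R : L.Relations n) (ts : Fin n → L.Term (Fin k)),
    γ = R.formula ts ∨ γ = ∼(R.formula ts)}

/-- A set of literals is *consistent* if it contains no formula together with its negation. -/
def Consistent {L : FirstOrder.Language.{u, v}} {k : ℕ} (S : Set (L.Formula (Fin k))) : Prop :=
  ∀ γ ∈ S, ∼γ ∉ S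

/-- The set of all `k`-types over `L`: the maximal consistent sets of non-equality literals in
the variables `x_1, …, x_k`. -/
def kTypes (k : ℕ) : Set (Set (L.Formula (Fin k))) :=
  {S | Maximal (fun S : Set (L.Formula (Fin k)) => S ⊆ Lit L k ∧ Consistent S) S}

end Types

section NormalForm

variable {L : FirstOrder.Language.{u, v}}

/-- Guarded sentences in *normal form*: finite conjunctions of
* existential sentences `∃ x̄ (α(x̄) ∧ ψ(x̄))`,
* universal sentences `∀ x̄ (α(x̄) → ψ(x̄))`,
* Skolem sentences `∀ x̄ (α(x̄) → ∃ ȳ (β(x̄, ȳ) ∧ ψ(x̄, ȳ)))`,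

where `x̄` is indexed by `Fin n`, `ȳ` by `Fin m`, the guards `α` and `β` are atomic (equalities are
allowed), `ψ` is quantifier-free, every variable of `x̄` occurs in `α`, and, in Skolem sentences,
every variable of `ȳ` and every variable of `ψ` occurs in `β`. -/
inductive IsNormalForm : L.Sentence → Prop
  | top : IsNormalForm ⊤
  | and (φ₁ φ₂ : L.Sentence) : IsNormalForm φ₁ → IsNormalForm φ₂ → IsNormalForm (φ₁ ⊓ φ₂)
  | existential (n : ℕ) (α ψ : L.Formula (Fin n)) :
      α.IsAtomic → ψ.IsQF → α.freeVarFinset = Finset.univ →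
      IsNormalForm (FirstOrder.Language.Formula.iExs (Fin n) (FirstOrder.Language.Formula.relabel Sum.inr (α ⊓ ψ)))
  | universal (n : ℕ) (α ψ : L.Formula (Fin n)) :
      α.IsAtomic → ψ.IsQF → α.freeVarFinset = Finset.univ →
      IsNormalForm (FirstOrder.Language.Formula.iAlls (Fin n) (FirstOrder.Language.Formula.relabel Sum.inr (α.imp ψ)))
  | skolem (n m : ℕ) (α : L.Formula (Fin n)) (β ψ : L.Formula (Fin n ⊕ Fin m)) :
      α.IsAtomic → β.IsAtomic → ψ.IsQF → α.freeVarFinset = Finset.univ →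
      (∀ j : Fin m, Sum.inr j ∈ β.freeVarFinset) → ψ.freeVarFinset ⊆ β.freeVarFinset →
      IsNormalForm (FirstOrder.Language.Formula.iAlls (Fin n)
        (FirstOrder.Language.Formula.relabel Sum.inr (α.imp (FirstOrder.Language.Formula.iExs (Fin m) (β ⊓ ψ)))))

end NormalForm

section Models

variable (L : FirstOrder.Language.{u, v}) (M : Type w) [L.Structure M]

/-- The *standard name assumption*: distinct constant symbols denote distinct elements (so that,
up to isomorphism, every constant symbol denotes itself). -/
def StandardNames : Prop :=
  Function.Injective fun c : L.Constants => (c : M)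

/-- The *unnamed domain*: the set of elements that are not denoted by a constant symbol. -/
def unnamed : Set M :=
  (Set.range fun c : L.Constants => (c : M))ᶜ

end Models

end GuardedFragment

/-! The model is cut out of a random structure on the constants and `size L` unnamed vertices. Write
w = `width L`. Over w - 1 fixed vertices, `newCard L` atoms pass through a further vertex b, so b
shows a prescribed pattern on them with probability 2 ^ (-`newCard L`) = |τ_{w-1}| / |τ_w|,
independently for distinct b. A union bound over tuples and patterns gives facts f in which every
such one-point extension occurs (`exists_realizing`, `size_inequality`, `exists_generic`).

Globally f need not resemble the given model M. But a partial isomorphism (`PIso`) into M on fewer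
than w vertices extends to any further unnamed element of M (`PIso.exists_insert`). Keep only the
vertices whose 1-type M realises, and only the facts whose vertices map partially isomorphically
into M (`domStructure`). Every true guard then lies in a copy of a part of M, so universal conjuncts
hold. Witnesses found in M are copied back by extending a partial isomorphism, because a guard spans
at most w unnamed elements (`PIso.exists_image_eq`, `realize_skolem`). -/

namespace GuardedFragment

/-! ### The union bound and its arithmetic -/

/-- The number of two-colourings of `A` that miss a prescribed pattern on each of the disjoint
blocks `g (b, ·)`. -/
theorem card_missing_le {A B E : Type*} [Fintype A] [Fintype B] [Fintype E]
    (g : B × E → A) (hg : Function.Injective g) (π : E → Bool) :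
    Nat.card {f : A → Bool // ∀ b, ∃ e, f (g (b, e)) ≠ π e} * 2 ^ (Fintype.card B * Fintype.card E)
      ≤ (2 ^ Fintype.card E - 1) ^ Fintype.card B * 2 ^ Fintype.card A := by
  classical
  let F : {f : A → Bool // ∀ b, ∃ e, f (g (b, e)) ≠ π e} →
      (B → {r : E → Bool // r ≠ π}) × ({x // x ∉ Set.range g} → Bool) := fun f =>
    (fun b => ⟨fun e => f.1 (g (b, e)), fun h => by
      obtain ⟨e, he⟩ := f.2 b
      exact he (congrFun h e)⟩, fun x => f.1 x.1)
  have hF : Function.Injective F := by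
    intro f f' h
    have h1 := congrArg Prod.fst h
    have h2 := congrArg Prod.snd h
    ext x
    by_cases hx : x ∈ Set.range g
    · obtain ⟨⟨b, e⟩, rfl⟩ := hx
      exact congrArg (fun r => r.1 e) (congrFun h1 b)
    · exact congrFun h2 ⟨x, hx⟩
  have hcard := Nat.card_le_card_of_injective F hF
  have hc : Fintype.card {x // x ∉ Set.range g} + Fintype.card B * Fintype.card E
      = Fintype.card A := by
    have h1 := Fintype.card_subtype_compl (fun x => x ∈ Set.range g)
    have h2 : Fintype.card {x // x ∈ Set.range g} = Fintype.card B * Fintype.card E := by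
      rw [← Fintype.card_prod]
      exact (Fintype.card_congr (Equiv.ofInjective g hg)).symm
    have h3 := Fintype.card_subtype_le (fun x => x ∈ Set.range g)
    omega
  have hr : Fintype.card {r : E → Bool // r ≠ π} = 2 ^ Fintype.card E - 1 := by
    simp
  rw [Nat.card_prod, Nat.card_fun, Nat.card_fun, Nat.card_eq_fintype_card (α := B),
    Nat.card_eq_fintype_card (α := {r // r ≠ π}), hr,
    Nat.card_eq_fintype_card (α := {x // x ∉ Set.range g}), Nat.card_eq_fintype_card (α := Bool),
    Fintype.card_bool] at hcard
  calc _ ≤ _ := Nat.mul_le_mul_right _ hcard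
    _ = _ := by rw [mul_assoc, ← pow_add, hc]

/-- A union bound: some two-colouring realises every pattern on some block of every family. -/
theorem exists_realizing {A I E : Type*} {B : I → Type*} [Fintype A] [Fintype I] [Fintype E]
    [∀ i, Fintype (B i)] (N : ℕ) (hB : ∀ i, Fintype.card (B i) = N)
    (g : ∀ i, B i × E → A) (hg : ∀ i, Function.Injective (g i))
    (hlt : Fintype.card I * 2 ^ Fintype.card E * (2 ^ Fintype.card E - 1) ^ N
      < (2 ^ Fintype.card E) ^ N) :
    ∃ f : A → Bool, ∀ i (π : E → Bool), ∃ b, ∀ e, f (g i (b, e)) = π e := by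
  classical
  by_contra! hcon
  let bad : I × (E → Bool) → Finset (A → Bool) := fun q =>
    Finset.univ.filter fun f => ∀ b, ∃ e, f (g q.1 (b, e)) ≠ q.2 e
  have hbad : ∀ q, (bad q).card * 2 ^ (N * Fintype.card E)
      ≤ (2 ^ Fintype.card E - 1) ^ N * 2 ^ Fintype.card A := fun q => by
    have := card_missing_le (g q.1) (hg q.1) q.2
    rw [hB, Nat.card_eq_fintype_card, Fintype.card_subtype] at this
    exact this
  have huniv : (Finset.univ : Finset (A → Bool)) = Finset.univ.biUnion bad := by
    ext f
    obtain ⟨i, π, h⟩ := hcon f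
    simp only [Finset.mem_univ, Finset.mem_biUnion, true_and, true_iff]
    exact ⟨(i, π), by simpa [bad] using h⟩
  have hsum : 2 ^ Fintype.card A ≤ ∑ q, (bad q).card := by
    have := Finset.card_biUnion_le (s := Finset.univ) (t := bad)
    rw [← huniv] at this
    simpa using this
  have h1 : 2 ^ Fintype.card A * 2 ^ (N * Fintype.card E) ≤
      Fintype.card I * 2 ^ Fintype.card E *
        ((2 ^ Fintype.card E - 1) ^ N * 2 ^ Fintype.card A) := by
    calc _ ≤ (∑ q, (bad q).card) * 2 ^ (N * Fintype.card E) := Nat.mul_le_mul_right _ hsum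
      _ = ∑ q, (bad q).card * 2 ^ (N * Fintype.card E) := Finset.sum_mul _ _ _
      _ ≤ ∑ _q : I × (E → Bool), (2 ^ Fintype.card E - 1) ^ N * 2 ^ Fintype.card A :=
          Finset.sum_le_sum fun q _ => hbad q
      _ = _ := by simp
  have h2 : (2 ^ Fintype.card E) ^ N = 2 ^ (N * Fintype.card E) := by rw [← pow_mul, mul_comm]
  rw [h2] at hlt
  have h3 := Nat.mul_lt_mul_of_pos_right hlt (Nat.two_pow_pos (Fintype.card A))
  nlinarith

/-- Bernoulli's inequality 1 + m/r ≤ (1 + 1/r)^m with denominators cleared. -/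
theorem add_mul_pow_le (r m : ℕ) : (r + m) * r ^ m ≤ r * (r + 1) ^ m := by
  induction m with
  | zero => simp
  | succ m ih =>
    calc (r + (m + 1)) * r ^ (m + 1) = r * (r + (m + 1)) * r ^ m := by ring
      _ ≤ (r + m) * (r + 1) * r ^ m := Nat.mul_le_mul_right _ (by nlinarith)
      _ = (r + m) * r ^ m * (r + 1) := by ring
      _ ≤ r * (r + 1) ^ m * (r + 1) := Nat.mul_le_mul_right _ ih
      _ = r * (r + 1) ^ (m + 1) := by ring

/-- This is (1 - 1/q)^q ≤ 1/2: q trials of success probability 1/q halve the failure probability. -/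
theorem two_mul_pred_pow_le (q : ℕ) (hq : 2 ≤ q) : 2 * (q - 1) ^ q ≤ q ^ q := by
  obtain ⟨r, rfl⟩ : ∃ r, q = r + 1 := ⟨q - 1, by omega⟩
  have hr : 0 < r := by omega
  rw [Nat.add_sub_cancel]
  refine Nat.le_of_mul_le_mul_left (le_trans ?_ (add_mul_pow_le r (r + 1))) hr
  rw [← mul_assoc]
  exact Nat.mul_le_mul_right _ (by omega)

/-- At least 15 q A² trials remain after discarding k vertices, where q = 2 ^ e, so a fixed pattern
fails with probability at most 2^(-15A²). The n^k q choices of tuple and pattern number at most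
2^((3A+4)k+A), whose exponent is again quadratic in A. This is the source of the squared logarithm.
-/
theorem size_inequality (e A k : ℕ) (he : 1 ≤ e) (heA : e ≤ A) (hk : k + 1 ≤ A) :
    (16 * 2 ^ e * A ^ 2) ^ k * 2 ^ e * (2 ^ e - 1) ^ (16 * 2 ^ e * A ^ 2 - k)
      < (2 ^ e) ^ (16 * 2 ^ e * A ^ 2 - k) := by
  set q := 2 ^ e with hq
  have hq2 : 2 ≤ q := by
    calc 2 = 2 ^ 1 := rfl
      _ ≤ 2 ^ e := Nat.pow_le_pow_right two_pos he
  have hA : 1 ≤ A := by omega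
  have hqA : q ≤ 2 ^ A := Nat.pow_le_pow_right two_pos heA
  have hA2 : A ≤ 2 ^ A := Nat.lt_two_pow_self.le
  have hn : 16 * q * A ^ 2 ≤ 2 ^ (3 * A + 4) := by
    calc 16 * q * A ^ 2 ≤ 16 * 2 ^ A * (2 ^ A) ^ 2 := by gcongr
      _ = 2 ^ (3 * A + 4) := by ring
  have hN : q * (15 * A ^ 2) ≤ 16 * q * A ^ 2 - k := by
    have : k ≤ q * A ^ 2 := by nlinarith
    have h2 : 16 * q * A ^ 2 = q * (15 * A ^ 2) + q * A ^ 2 := by ring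
    omega
  obtain ⟨d, hd⟩ := Nat.exists_eq_add_of_le hN
  have hleft : (16 * q * A ^ 2) ^ k * q < 2 ^ (15 * A ^ 2) := by
    calc (16 * q * A ^ 2) ^ k * q ≤ (2 ^ (3 * A + 4)) ^ k * 2 ^ A := by gcongr
      _ = 2 ^ ((3 * A + 4) * k + A) := by rw [← pow_mul, ← pow_add]
      _ < 2 ^ (15 * A ^ 2) := Nat.pow_lt_pow_right (by norm_num) (by nlinarith)
  have hpow : 2 ^ (15 * A ^ 2) * (q - 1) ^ (q * (15 * A ^ 2)) ≤ q ^ (q * (15 * A ^ 2)) := by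
    rw [pow_mul (q - 1), pow_mul q, ← mul_pow]
    exact Nat.pow_le_pow_left (two_mul_pred_pow_le q hq2) _
  rw [hd, pow_add, pow_add]
  have hpos : 0 < (q - 1) ^ (q * (15 * A ^ 2)) := Nat.pow_pos (by omega)
  calc (16 * q * A ^ 2) ^ k * q * ((q - 1) ^ (q * (15 * A ^ 2)) * (q - 1) ^ d)
      = ((16 * q * A ^ 2) ^ k * q * (q - 1) ^ (q * (15 * A ^ 2))) * (q - 1) ^ d := by ring
    _ < (2 ^ (15 * A ^ 2) * (q - 1) ^ (q * (15 * A ^ 2))) * q ^ d := by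
        refine Nat.mul_lt_mul_of_lt_of_le (Nat.mul_lt_mul_of_pos_right hleft hpos)
          (Nat.pow_le_pow_left (by omega) _) (Nat.pow_pos (by omega))
    _ ≤ _ := Nat.mul_le_mul_right _ hpow

/-! ### Structures with all one-point extensions -/

/-- Atoms over the vertex set `X`: a symbol of `ρ` together with a tuple of its arity. -/
abbrev Atom {ρ : Type*} (ar : ρ → ℕ) (X : Type*) := Σ R : ρ, (Fin (ar R) → X)

/-- The atoms over `C ⊕ Option K` in which the distinguished vertex `none` occurs. -/
abbrev NewAtom {ρ : Type*} (ar : ρ → ℕ) (C K : Type*) :=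
  {A : Atom ar (C ⊕ Option K) // ∃ i, A.2 i = Sum.inr none}

/-- Atoms split by whether `none` occurs. Hence 2 to the number of new atoms is a quotient of
numbers of types. -/
theorem card_newAtom {ρ : Type*} [Finite ρ] (ar : ρ → ℕ) (C K : Type*) [Finite C] [Finite K] :
    Nat.card (NewAtom ar C K) + Nat.card (Atom ar (C ⊕ K))
      = Nat.card (Atom ar (C ⊕ Option K)) := by
  classical
  have hE : {A : Atom ar (C ⊕ Option K) // ¬ ∃ i, A.2 i = Sum.inr none} ≃ Atom ar (C ⊕ K) :=
    (Equiv.ofBijective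
      (fun A : Atom ar (C ⊕ K) =>
        (⟨⟨A.1, fun i => Sum.map id some (A.2 i)⟩, by
          rintro ⟨i, hi⟩
          rcases h : A.2 i with c | x <;> simp [h] at hi⟩ :
          {A : Atom ar (C ⊕ Option K) // ¬ ∃ i, A.2 i = Sum.inr none}))
      ⟨by
        rintro ⟨R, t⟩ ⟨R', t'⟩ h
        simp only [Subtype.mk.injEq, Sigma.mk.injEq] at h
        obtain ⟨rfl, h⟩ := h
        have h := eq_of_heq h
        congr 1
        funext i
        exact (Sum.map_injective.2 ⟨Function.injective_id, Option.some_injective _⟩)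
          (congrFun h i), by
        rintro ⟨⟨R, t⟩, ht⟩
        have : ∀ i, ∃ y : C ⊕ K, Sum.map id some y = t i := fun i => by
          rcases h : t i with c | x
          · exact ⟨Sum.inl c, rfl⟩
          · cases x with
            | none => exact absurd ⟨i, h⟩ ht
            | some x => exact ⟨Sum.inr x, rfl⟩
        choose s hs using this
        exact ⟨⟨R, s⟩, by simp [hs]⟩⟩).symm
  rw [← Nat.card_congr hE, ← Nat.card_sum]
  exact Nat.card_congr (Equiv.sumCompl _)

/-- Substitute the tuple `a` and the point `b` for the variables. -/
def place {C K V : Type*} (a : K → V) (b : V) : C ⊕ Option K → C ⊕ V :=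
  Sum.map id fun o => o.elim b a

/-- For fixed `a`, the blocks of atoms belonging to different points b are disjoint, since each atom
contains its own b and otherwise only constants and points of `a`. So `exists_realizing` applies
with n - k blocks. -/
theorem exists_extension_structure {ρ : Type*} [Finite ρ] (ar : ρ → ℕ) {C : Type*} [Finite C]
    (k n : ℕ)
    (hlt : n ^ k * 2 ^ Nat.card (NewAtom ar C (Fin k)) *
        (2 ^ Nat.card (NewAtom ar C (Fin k)) - 1) ^ (n - k)
      < (2 ^ Nat.card (NewAtom ar C (Fin k))) ^ (n - k)) :
    ∃ f : Atom ar (C ⊕ Fin n) → Bool,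
      ∀ (a : Fin k ↪ Fin n) (π : NewAtom ar C (Fin k) → Bool), ∃ b, b ∉ Set.range a ∧
        ∀ A : NewAtom ar C (Fin k), f ⟨A.1.1, fun i => place a b (A.1.2 i)⟩ = π A := by
  classical
  have := Fintype.ofFinite ρ
  have := Fintype.ofFinite C
  have hinj : ∀ (a : Fin k ↪ Fin n) (b : Fin n), b ∉ Set.range a →
      Function.Injective (place (C := C) a b) := by
    intro a b hb
    refine Sum.map_injective.2 ⟨Function.injective_id, ?_⟩
    rintro (_ | x) (_ | y) h
    · rfl
    · exact absurd ⟨y, h.symm⟩ hb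
    · exact absurd ⟨x, h⟩ hb
    · exact congrArg some (a.injective h)
  obtain ⟨f, hf⟩ := exists_realizing (A := Atom ar (C ⊕ Fin n)) (I := Fin k ↪ Fin n)
    (E := NewAtom ar C (Fin k)) (B := fun a => {b : Fin n // b ∉ Set.range a}) (n - k)
    (fun a => by
      have h := Fintype.card_subtype_compl (fun x => x ∈ Set.range a)
      rw [h, Fintype.card_fin]
      congr 1
      rw [← Fintype.card_congr (Equiv.ofInjective a a.injective), Fintype.card_fin])
    (fun a p => ⟨p.2.1.1, fun i => place a p.1.1 (p.2.1.2 i)⟩)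
    (by
      rintro a ⟨⟨b, hb⟩, ⟨⟨R, t⟩, i, hi⟩⟩ ⟨⟨b', hb'⟩, ⟨⟨R', t'⟩, i', hi'⟩⟩ h
      simp only [Sigma.mk.injEq] at h
      obtain ⟨rfl, h⟩ := h
      have h := eq_of_heq h
      have hbb : b = b' := by
        have h1 := congrFun h i
        simp only at hi hi'
        rw [hi] at h1
        rcases ht : t' i with c | (_ | x) <;> rw [ht] at h1
        · simp [place] at h1
        · simpa [place] using h1
        · exact absurd ⟨x, by simpa [place] using h1.symm⟩ hb
      subst hbb
      have : t = t' := by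
        funext j
        exact hinj a b hb (congrFun h j)
      subst this
      rfl)
    (by
      rw [← Nat.card_eq_fintype_card (α := NewAtom ar C (Fin k))]
      refine lt_of_le_of_lt ?_ hlt
      gcongr
      rw [Fintype.card_embedding_eq, Fintype.card_fin, Fintype.card_fin]
      exact Nat.descFactorial_le_pow n k)
  refine ⟨f, fun a π => ?_⟩
  obtain ⟨b, hb⟩ := hf a π
  exact ⟨b.1, b.2, hb⟩

end GuardedFragment

/-! ### Counting types by atoms -/

namespace GuardedFragment

open FirstOrder Language

section

variable {L : FirstOrder.Language.{u, v}}

/-- In a signature, a term is a constant symbol or a variable. -/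
theorem bijective_termOfSum (h : IsSignature L) (X : Type*) :
    Function.Bijective (Sum.elim (fun c : L.Constants => (c.term : L.Term X)) Term.var) := by
  constructor
  · rintro (c | x) (c' | x') hx
    · simp only [Sum.elim_inl, Constants.term] at hx
      injection hx with _ h1
      exact congrArg Sum.inl (eq_of_heq (by simpa using h1))
    · simp [Constants.term] at hx
    · simp [Constants.term] at hx
    · simpa using hx
  · rintro (x | @⟨n, f, ts⟩)
    · exact ⟨Sum.inr x, rfl⟩
    · cases n with
      | zero =>
        refine ⟨Sum.inl f, ?_⟩
        simp only [Sum.elim_inl, Constants.term]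
        congr 1
        exact Subsingleton.elim _ _
      | succ n => exact ((h.no_functions n).false f).elim

noncomputable def sumEquivTerm (h : IsSignature L) (X : Type*) : L.Constants ⊕ X ≃ L.Term X :=
  Equiv.ofBijective _ (bijective_termOfSum h X)

variable (L) in
/-- The atoms of `L` over the vertex set `X`. -/
abbrev LAtom (X : Type*) := Atom (fun R : Σ n, L.Relations n => R.1) X

def LAtom.formula {X : Type*} (A : LAtom L (L.Term X)) : L.Formula X := A.1.2.formula A.2

theorem LAtom.formula_injective {X : Type*} :
    Function.Injective (LAtom.formula : LAtom L (L.Term X) → L.Formula X) := by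
  rintro ⟨⟨n, R⟩, t⟩ ⟨⟨n', R'⟩, t'⟩ h
  simp only [LAtom.formula, Relations.formula, Relations.boundedFormula] at h
  injection h with h0 h1 h2 h3
  subst h1
  obtain rfl := eq_of_heq h2
  congr 1
  funext i
  have := congrFun (eq_of_heq h3) i
  simpa [Term.relabel_relabel, Function.comp_def, ← Function.id_def, Term.relabel_id] using
    congrArg (Term.relabel (Sum.elim id finZeroElim)) this

theorem LAtom.formula_ne_not {X : Type*} (A : LAtom L (L.Term X)) (φ : L.Formula X) :
    A.formula ≠ ∼φ := by
  intro h
  simp only [LAtom.formula, Relations.formula, Relations.boundedFormula, BoundedFormula.not] at h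
  cases h

theorem not_injective {X : Type*} {φ ψ : L.Formula X} (h : ∼φ = ∼ψ) : φ = ψ := by
  simp only [BoundedFormula.not] at h
  injection h

/-- The complete set of literals given by the set `s` of atoms. -/
def typeOf {k : ℕ} (s : Set (LAtom L (L.Term (Fin k)))) : Set (L.Formula (Fin k)) :=
  {γ | (∃ A ∈ s, γ = A.formula) ∨ ∃ A ∉ s, γ = ∼A.formula}

theorem formula_mem_typeOf {k : ℕ} {s : Set (LAtom L (L.Term (Fin k)))}
    {A : LAtom L (L.Term (Fin k))} : A.formula ∈ typeOf s ↔ A ∈ s := by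
  constructor
  · rintro (⟨B, hB, h⟩ | ⟨B, _, h⟩)
    · rwa [LAtom.formula_injective h]
    · exact (A.formula_ne_not _ h).elim
  · exact fun h => Or.inl ⟨A, h, rfl⟩

theorem not_formula_mem_typeOf {k : ℕ} {s : Set (LAtom L (L.Term (Fin k)))}
    {A : LAtom L (L.Term (Fin k))} : ∼A.formula ∈ typeOf s ↔ A ∉ s := by
  constructor
  · rintro (⟨B, _, h⟩ | ⟨B, hB, h⟩)
    · exact (B.formula_ne_not _ h.symm).elim
    · rwa [LAtom.formula_injective (not_injective h)]
  · exact fun h => Or.inr ⟨A, h, rfl⟩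

theorem mem_Lit_iff {k : ℕ} {γ : L.Formula (Fin k)} :
    γ ∈ Lit L k ↔ ∃ A : LAtom L (L.Term (Fin k)), γ = A.formula ∨ γ = ∼A.formula :=
  ⟨fun ⟨n, R, ts, h⟩ => ⟨⟨⟨n, R⟩, ts⟩, h⟩, fun ⟨A, h⟩ => ⟨A.1.1, A.1.2, A.2, h⟩⟩

/-- Maximality forces every atom to be decided, so a type is determined by the set of atoms it
contains, and this set is arbitrary. -/
theorem kTypes_eq_range (k : ℕ) : kTypes L k = Set.range (typeOf (L := L) (k := k)) := by
  ext S
  constructor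
  · rintro ⟨⟨hL, hc⟩, hmax⟩
    have hsub : S ⊆ typeOf {A | A.formula ∈ S} := by
      intro γ hγ
      obtain ⟨A, rfl | rfl⟩ := mem_Lit_iff.1 (hL hγ)
      · exact formula_mem_typeOf.2 hγ
      · exact not_formula_mem_typeOf.2 fun h => hc _ h hγ
    refine ⟨{A | A.formula ∈ S}, Set.Subset.antisymm (hmax ⟨?_, ?_⟩ hsub) hsub⟩
    · rintro γ (⟨A, _, rfl⟩ | ⟨A, _, rfl⟩)
      exacts [mem_Lit_iff.2 ⟨A, Or.inl rfl⟩, mem_Lit_iff.2 ⟨A, Or.inr rfl⟩]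
    · rintro γ (⟨A, hA, rfl⟩ | ⟨A, _, rfl⟩) h
      · exact not_formula_mem_typeOf.1 h hA
      -- A doubly negated atom is neither an atom nor a negated atom.
      · rcases h with ⟨B, _, h⟩ | ⟨B, _, h⟩
        · exact B.formula_ne_not _ h.symm
        · exact B.formula_ne_not _ (not_injective h).symm
  · rintro ⟨s, rfl⟩
    refine ⟨⟨?_, ?_⟩, ?_⟩
    · rintro γ (⟨A, _, rfl⟩ | ⟨A, _, rfl⟩)
      exacts [mem_Lit_iff.2 ⟨A, Or.inl rfl⟩, mem_Lit_iff.2 ⟨A, Or.inr rfl⟩]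
    · rintro γ (⟨A, hA, rfl⟩ | ⟨A, _, rfl⟩) h
      · exact not_formula_mem_typeOf.1 h hA
      · rcases h with ⟨B, _, h⟩ | ⟨B, _, h⟩
        · exact B.formula_ne_not _ h.symm
        · exact B.formula_ne_not _ (not_injective h).symm
    · rintro T ⟨hL, hc⟩ hsT γ hγ
      obtain ⟨A, rfl | rfl⟩ := mem_Lit_iff.1 (hL hγ)
      · by_contra h
        exact hc _ hγ (hsT (not_formula_mem_typeOf.2 fun hA => h (formula_mem_typeOf.2 hA)))
      · refine not_formula_mem_typeOf.2 fun hA => hc _ (hsT (formula_mem_typeOf.2 hA)) hγ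

theorem ncard_kTypes (h : IsSignature L) (k : ℕ) :
    (kTypes L k).ncard = 2 ^ Nat.card (LAtom L (L.Constants ⊕ Fin k)) := by
  have := h.finite_constants
  have := h.finite_relations
  have hinj : Function.Injective (typeOf (L := L) (k := k)) := fun s t hst => by
    ext A
    rw [← formula_mem_typeOf, hst, formula_mem_typeOf]
  have hatoms : Nat.card (LAtom L (L.Term (Fin k))) = Nat.card (LAtom L (L.Constants ⊕ Fin k)) :=
    Nat.card_congr (Equiv.sigmaCongrRight fun R =>
      (Equiv.refl (Fin R.1)).arrowCongr (sumEquivTerm h (Fin k)).symm)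
  have : Finite (L.Term (Fin k)) := Finite.of_equiv _ (sumEquivTerm h (Fin k))
  rw [kTypes_eq_range, ← Set.image_univ, Set.ncard_image_of_injective _ hinj, Set.ncard_univ,
    ← hatoms]
  exact Nat.card_fun.trans (by simp)

theorem finite_arities (h : IsSignature L) : {n | Nonempty (L.Relations n)}.Finite := by
  have := h.finite_relations
  refine (Set.finite_range fun R : Σ n, L.Relations n => R.1).subset ?_
  rintro n ⟨R⟩
  exact ⟨⟨n, R⟩, rfl⟩

theorem le_width (h : IsSignature L) {n : ℕ} (R : L.Relations n) : n ≤ width L :=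
  le_csSup (finite_arities h).bddAbove ⟨R⟩

theorem nonempty_relations_width (h : IsSignature L) : Nonempty (L.Relations (width L)) := by
  obtain ⟨⟨n, R⟩⟩ := h.nonempty_relations
  exact Nat.sSup_mem (s := {n | Nonempty (L.Relations n)}) ⟨n, ⟨R⟩⟩ (finite_arities h).bddAbove

theorem one_le_width (h : IsSignature L) : 1 ≤ width L := by
  obtain ⟨R⟩ := nonempty_relations_width h
  by_contra hw
  have : width L = 0 := by omega
  rw [this] at R
  exact h.arity_pos.false R

/-- The diagonal atoms R(x_j, …, x_j) of a symbol of maximal arity are distinct. This supplies the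
hypothesis k + 1 ≤ A of `size_inequality`. -/
theorem width_le_card (h : IsSignature L) :
    width L ≤ Nat.card (LAtom L (L.Constants ⊕ Fin (width L))) := by
  have := h.finite_constants
  have := h.finite_relations
  obtain ⟨R⟩ := nonempty_relations_width h
  have hw := one_le_width h
  have hinj : Function.Injective fun j : Fin (width L) =>
      (⟨⟨width L, R⟩, fun _ => Sum.inr j⟩ : LAtom L (L.Constants ⊕ Fin (width L))) := by
    intro j j' hj
    simp only [Sigma.mk.injEq, heq_eq_eq, true_and] at hj
    simpa using congrFun hj ⟨0, hw⟩
  simpa using Nat.card_le_card_of_injective _ hinj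

/-- The number of non-constant atoms containing a prescribed one of `width L` variables. -/
noncomputable def newCard (L : FirstOrder.Language.{u, v}) : ℕ :=
  Nat.card (NewAtom (fun R : Σ n, L.Relations n => R.1) L.Constants (Fin (width L - 1)))

theorem newCard_add (h : IsSignature L) :
    newCard L + Nat.card (LAtom L (L.Constants ⊕ Fin (width L - 1)))
      = Nat.card (LAtom L (L.Constants ⊕ Fin (width L))) := by
  have := h.finite_constants
  have := h.finite_relations
  rw [newCard, card_newAtom]
  have hw := one_le_width h
  obtain ⟨k, hk⟩ : ∃ k, width L = k + 1 := ⟨width L - 1, by omega⟩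
  rw [hk, Nat.add_sub_cancel]
  exact Nat.card_congr (Equiv.sigmaCongrRight fun R => (Equiv.refl (Fin R.1)).arrowCongr
    ((Equiv.refl L.Constants).sumCongr (finSuccEquiv k).symm))

theorem one_le_newCard (h : IsSignature L) : 1 ≤ newCard L := by
  have := h.finite_constants
  have := h.finite_relations
  obtain ⟨R⟩ := nonempty_relations_width h
  have : Nonempty (NewAtom (fun R : Σ n, L.Relations n => R.1) L.Constants (Fin (width L - 1))) :=
    ⟨⟨⟨width L, R⟩, fun _ => Sum.inr none⟩, ⟨0, one_le_width h⟩, rfl⟩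
  exact Nat.card_pos

/-- The number of unnamed vertices used for the random structure. -/
noncomputable def size (L : FirstOrder.Language.{u, v}) : ℕ :=
  16 * 2 ^ newCard L * Nat.card (LAtom L (L.Constants ⊕ Fin (width L))) ^ 2

/-- The number of atoms is the base-2 logarithm of the number of types; changing to natural
logarithms produces the factor 1 / (log 2)². -/
theorem size_eq (h : IsSignature L) :
    (size L : ℝ) = 16 / Real.log 2 ^ 2 *
      (((kTypes L (width L)).ncard : ℝ) / ((kTypes L (width L - 1)).ncard : ℝ)) *
        Real.log ((kTypes L (width L)).ncard : ℝ) ^ 2 := by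
  have hlog : Real.log 2 ≠ 0 := (Real.log_pos one_lt_two).ne'
  rw [ncard_kTypes h, ncard_kTypes h, size, ← newCard_add h, pow_add]
  push_cast
  rw [← pow_add, Real.log_pow]
  push_cast
  field_simp
  ring

theorem width_le_size (h : IsSignature L) : width L ≤ size L := by
  have h1 := width_le_card h
  have h2 := Nat.two_pow_pos (newCard L)
  have h3 := one_le_width h
  rw [size]
  nlinarith [Nat.mul_le_mul h2 (Nat.pow_le_pow_left h1 2)]

end

end GuardedFragment

/-! ### Generic facts and partial isomorphisms into the given model -/

namespace GuardedFragment

open FirstOrder Language Structure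

section Generic

variable {L : FirstOrder.Language.{u, v}} {M : Type w} [L.Structure M] {n : ℕ}

variable (L) in
/-- Extend a map on the unnamed vertices by the interpretation of the constants. -/
def hat (p : Fin n → M) : L.Constants ⊕ Fin n → M := Sum.elim (fun c => (c : M)) p

/-- The vertex `x` is a constant or belongs to `S`. -/
def Over {C V : Type*} (S : Set V) (x : C ⊕ V) : Prop := ∀ b, x = Sum.inr b → b ∈ S

theorem Over.mono {C V : Type*} {S T : Set V} (hST : S ⊆ T) {x : C ⊕ V} (h : Over S x) :
    Over T x := fun b hb => hST (h b hb)

theorem hat_congr {S : Set (Fin n)} {p q : Fin n → M} (hpq : Set.EqOn p q S)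
    {x : L.Constants ⊕ Fin n} (hx : Over S x) : hat L p x = hat L q x := by
  rcases x with c | b
  · rfl
  · exact hpq (hx b rfl)

/-- On the vertices over `S`, the map `p` is a partial isomorphism from the structure with set of
facts `f` to `M`. -/
structure PIso (f : LAtom L (L.Constants ⊕ Fin n) → Prop) (S : Set (Fin n)) (p : Fin n → M) :
    Prop where
  injOn : Set.InjOn p S
  mapsTo : Set.MapsTo p S (unnamed L M)
  iff_relMap : ∀ A : LAtom L (L.Constants ⊕ Fin n), (∀ i, Over S (A.2 i)) →
    (f A ↔ RelMap A.1.2 fun i => hat L p (A.2 i))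

theorem PIso.mono {f : LAtom L (L.Constants ⊕ Fin n) → Prop} {S T : Set (Fin n)} {p : Fin n → M}
    (h : PIso f T p) (hST : S ⊆ T) : PIso f S p :=
  ⟨h.injOn.mono hST, h.mapsTo.mono_left hST,
    fun A hA => h.iff_relMap A fun i => (hA i).mono hST⟩

theorem PIso.congr {f : LAtom L (L.Constants ⊕ Fin n) → Prop} {S : Set (Fin n)} {p q : Fin n → M}
    (h : PIso f S p) (hpq : Set.EqOn p q S) : PIso f S q :=
  ⟨h.injOn.congr hpq, h.mapsTo.congr hpq, fun A hA => by
    rw [h.iff_relMap A hA, show (fun i => hat L p (A.2 i)) = fun i => hat L q (A.2 i) from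
      funext fun i => hat_congr hpq (hA i)]⟩

/-- The facts `f` agree with `M` on the constants, and realise every one-point extension of every
set of less than `width L` vertices. -/
structure Generic (M : Type w) [L.Structure M] (f : LAtom L (L.Constants ⊕ Fin n) → Prop) :
    Prop where
  constants : ∀ (p : Fin n → M) (A : LAtom L (L.Constants ⊕ Fin n)), (∀ i, Over ∅ (A.2 i)) →
    (f A ↔ RelMap A.1.2 fun i => hat L p (A.2 i))
  extension : ∀ (S : Set (Fin n)) (p : Fin n → M) (m : M), S.ncard < width L → ∃ b, b ∉ S ∧
    ∀ A : LAtom L (L.Constants ⊕ Fin n), (∃ i, A.2 i = Sum.inr b) →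
      (∀ i, Over (insert b S) (A.2 i)) →
      (f A ↔ RelMap A.1.2 fun i => hat L (Function.update p b m) (A.2 i))

theorem exists_generic (h : IsSignature L) (M : Type w) [L.Structure M] :
    ∃ f : LAtom L (L.Constants ⊕ Fin (size L)) → Prop, Generic M f := by
  classical
  have := h.finite_constants
  have := h.finite_relations
  have hw := one_le_width h
  obtain ⟨f, hf⟩ := exists_extension_structure (fun R : Σ n, L.Relations n => R.1)
    (C := L.Constants) (width L - 1) (size L) (size_inequality (newCard L) _ (width L - 1)
      (one_le_newCard h) ((Nat.le_add_right _ _).trans (newCard_add h).le)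
      (by have := width_le_card h; omega))
  -- Facts about constants alone are overwritten by those of M. Extension is unaffected, as it
  -- concerns only atoms through a new vertex. The choice of `p` is immaterial here.
  refine ⟨fun A => if ∀ i, Over ∅ (A.2 i) then
    ∃ p : Fin (size L) → M, RelMap A.1.2 fun i => hat L p (A.2 i) else f A = true, ?_, ?_⟩
  · intro p A hA
    rw [if_pos hA]
    refine ⟨fun ⟨q, hq⟩ => ?_, fun hp => ⟨p, hp⟩⟩
    convert hq using 2 with i
    exact hat_congr (Set.eqOn_empty _ _) (hA i)
  · intro S p m hS
    -- The random structure handles tuples of exactly `width L - 1` vertices, so S is padded; the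
    -- values of `p` on the padding do no harm.
    obtain ⟨T, hST, hT⟩ := Finset.exists_superset_card_eq (s := S.toFinset) (n := width L - 1)
      (by rw [← Set.ncard_eq_toFinset_card']; omega)
      (by have := width_le_size h; rw [Fintype.card_fin]; omega)
    let a : Fin (width L - 1) ↪ Fin (size L) := (T.orderEmbOfFin hT).toEmbedding
    have hSa : S ⊆ Set.range a := by
      intro s hs
      have : s ∈ Set.range (T.orderEmbOfFin hT) := by
        rw [Finset.range_orderEmbOfFin]
        exact hST (by simpa using hs)
      exact this
    obtain ⟨b, hb, hfb⟩ := hf a fun B => decide (RelMap B.1.1.2 fun i =>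
      Sum.elim (fun c : L.Constants => (c : M)) (fun o : Option (Fin (width L - 1)) =>
        o.elim m (p ∘ a)) (B.1.2 i))
    refine ⟨b, fun hbS => hb (hSa hbS), ?_⟩
    rintro ⟨R, t⟩ ⟨i₀, hi₀⟩ hA
    simp only at hi₀ hA
    have hpre : ∀ i, ∃ y, place a b y = t i := fun i => by
      rcases ht : t i with c | x
      · exact ⟨Sum.inl c, rfl⟩
      · rcases hA i x ht with rfl | hx
        · exact ⟨Sum.inr none, rfl⟩
        · obtain ⟨j, rfl⟩ := hSa hx
          exact ⟨Sum.inr (some j), rfl⟩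
    choose s hs using hpre
    have hnone : s i₀ = Sum.inr none := by
      have h1 := hs i₀
      rw [hi₀] at h1
      rcases hsi : s i₀ with c | (_ | x) <;> simp only [hsi] at h1
      · simp [place] at h1
      · rfl
      · exact absurd ⟨x, by simpa [place] using h1⟩ hb
    rw [if_neg fun hcon => hcon i₀ b hi₀]
    have h2 := hfb ⟨⟨R, s⟩, i₀, hnone⟩
    simp only [hs] at h2
    rw [h2, decide_eq_true_iff, iff_iff_eq]
    congr 1
    funext i
    change _ = hat L _ (t i)
    rw [← hs i]
    rcases s i with c | (_ | x)
    · rfl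
    · simp [place, hat]
    · have : a x ≠ b := fun hx => hb ⟨x, hx⟩
      simp [place, hat, this]

variable {f : LAtom L (L.Constants ⊕ Fin n) → Prop}

theorem Generic.pIso_empty (hf : Generic M f) (p : Fin n → M) : PIso f ∅ p :=
  ⟨Set.injOn_empty _, Set.mapsTo_empty _ _, hf.constants p⟩

/-- Atoms through the new vertex are correct by genericity; all others already lie over S. -/
theorem PIso.exists_insert {S : Set (Fin n)} {p : Fin n → M} (hp : PIso f S p) (hf : Generic M f)
    (hS : S.ncard < width L) {m : M} (hm : m ∈ unnamed L M) (hmp : m ∉ p '' S) :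
    ∃ b, b ∉ S ∧ PIso f (insert b S) (Function.update p b m) := by
  obtain ⟨b, hb, hfb⟩ := hf.extension S p m hS
  have heq : Set.EqOn p (Function.update p b m) S := fun s hs => by
    rw [Function.update_of_ne (ne_of_mem_of_not_mem hs hb)]
  have hp' := hp.congr heq
  refine ⟨b, hb, (Set.injOn_insert hb).2 ⟨hp'.injOn, ?_⟩, ?_, ?_⟩
  · rwa [← heq.image_eq, Function.update_self]
  · rintro s (rfl | hs)
    · rwa [Function.update_self]
    · exact hp'.mapsTo hs
  · intro A hA
    by_cases hbA : ∃ i, A.2 i = Sum.inr b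
    · exact hfb A hbA hA
    · refine hp'.iff_relMap A fun i x hx => ?_
      rcases hA i x hx with rfl | hxS
      · exact (hbA ⟨i, hx⟩).elim
      · exact hxS

/-- Points of Y are added one at a time. As long as one is missing, injectivity gives |S| < |Y| ≤
`width L`, so another extension is available. -/
theorem PIso.exists_image_eq (hf : Generic M f) {Y : Set M} (hYf : Y.Finite)
    (hYw : Y.ncard ≤ width L) (hYu : Y ⊆ unnamed L M) (d : ℕ) :
    ∀ (S : Set (Fin n)) (p : Fin n → M), PIso f S p → p '' S ⊆ Y → Y.ncard ≤ S.ncard + d →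
      ∃ S' p', S ⊆ S' ∧ PIso f S' p' ∧ Set.EqOn p p' S ∧ p' '' S' = Y := by
  induction d with
  | zero =>
    intro S p hp hpY hd
    refine ⟨S, p, subset_rfl, hp, Set.eqOn_refl _ _, Set.eq_of_subset_of_ncard_le hpY ?_ hYf⟩
    rw [hp.injOn.ncard_image]
    exact hd
  | succ d ih =>
    intro S p hp hpY hd
    by_cases hY : Y ⊆ p '' S
    · exact ⟨S, p, subset_rfl, hp, Set.eqOn_refl _ _, hpY.antisymm hY⟩
    · obtain ⟨m, hmY, hm⟩ := Set.not_subset.1 hY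
      have hlt : S.ncard < width L := by
        rw [← hp.injOn.ncard_image]
        exact (Set.ncard_lt_ncard (hpY.ssubset_of_mem_notMem hmY hm) hYf).trans_le hYw
      obtain ⟨b, hb, hpb⟩ := hp.exists_insert hf hlt (hYu hmY) hm
      have heq : Set.EqOn p (Function.update p b m) S := fun s hs => by
        rw [Function.update_of_ne (ne_of_mem_of_not_mem hs hb)]
      obtain ⟨S', p', hS, hp', he, hi⟩ := ih _ _ hpb
        (by
          rw [Set.image_insert_eq, Function.update_self, ← heq.image_eq]
          exact Set.insert_subset hmY hpY)
        (by rw [Set.ncard_insert_of_notMem hb]; omega)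
      exact ⟨S', p', (Set.subset_insert _ _).trans hS, hp',
        heq.trans (he.mono (Set.subset_insert _ _)), hi⟩

/-! ### The finite structure and transfer of quantifier-free formulas -/

/-- The constants together with the unnamed vertices whose 1-type is realised in `M`. -/
abbrev Dom (M : Type w) [L.Structure M] (f : LAtom L (L.Constants ⊕ Fin n) → Prop) :=
  {x : L.Constants ⊕ Fin n // ∀ b, x = Sum.inr b → ∃ p : Fin n → M, PIso f {b} p}

/-- The structure on `Dom M f` whose facts are those facts of `f` that live on a set of vertices
isomorphic to a part of `M`. -/
@[reducible] def domStructure (h : IsSignature L) (M : Type w) [L.Structure M]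
    (f : LAtom L (L.Constants ⊕ Fin n) → Prop) : L.Structure (Dom M f) where
  funMap {k} F _ := match k, F with
    | 0, c => ⟨Sum.inl c, fun _ hb => by cases hb⟩
    | k + 1, F => ((h.no_functions k).false F).elim
  RelMap R v := ∃ p : Fin n → M,
    PIso f {b | ∃ i, (v i).1 = Sum.inr b} p ∧ RelMap R fun i => hat L p (v i).1

/-- The witness in the definition of the relations can be exchanged for any other partial
isomorphism covering the tuple, because both agree with `f`. -/
theorem PIso.relMap_iff (h : IsSignature L) {S : Set (Fin n)} {p : Fin n → M} (hp : PIso f S p)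
    {k : ℕ} (R : L.Relations k) (v : Fin k → Dom M f) (hv : ∀ i, Over S (v i).1) :
    letI := domStructure h M f
    RelMap R v ↔ RelMap R fun i => hat L p (v i).1 := by
  have hsub : {b | ∃ i, (v i).1 = Sum.inr b} ⊆ S := by
    rintro b ⟨i, hi⟩
    exact hv i b hi
  refine ⟨?_, fun hR => ⟨p, hp.mono hsub, hR⟩⟩
  rintro ⟨q, hq, hR⟩
  have h1 := hq.iff_relMap ⟨⟨k, R⟩, fun i => (v i).1⟩ fun i b hb => ⟨i, hb⟩
  have h2 := hp.iff_relMap ⟨⟨k, R⟩, fun i => (v i).1⟩ hv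
  exact h2.1 (h1.2 hR)

theorem PIso.injOn_hat (hM : StandardNames L M) {S : Set (Fin n)} {p : Fin n → M}
    (hp : PIso f S p) {x y : L.Constants ⊕ Fin n} (hx : Over S x) (hy : Over S y)
    (hxy : hat L p x = hat L p y) : x = y := by
  rcases x with c | b <;> rcases y with c' | b'
  · exact congrArg Sum.inl (hM hxy)
  · exact (hp.mapsTo (hy b' rfl) ⟨c, hxy⟩).elim
  · exact (hp.mapsTo (hx b rfl) ⟨c', hxy.symm⟩).elim
  · exact congrArg Sum.inr (hp.injOn (hx b rfl) (hy b' rfl) hxy)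

/-- In a signature, a term is a constant symbol or a variable. -/
theorem term_cases (h : IsSignature L) {X : Type*} (t : L.Term X) :
    (∃ c : L.Constants, t = c.term) ∨ ∃ x, t = Term.var x := by
  obtain ⟨c | x, rfl⟩ := (bijective_termOfSum h X).2 t
  exacts [Or.inl ⟨c, rfl⟩, Or.inr ⟨x, rfl⟩]

theorem realize_eq_of_mem (h : IsSignature L) {X N : Type*} [DecidableEq X] [L.Structure N]
    (t : L.Term (X ⊕ Fin 0)) {i : X} (hi : i ∈ t.varFinsetLeft) (x : X → N) (xs : Fin 0 → N) :
    t.realize (Sum.elim x xs) = x i := by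
  obtain ⟨c, rfl⟩ | ⟨j | j, rfl⟩ := term_cases h t
  · simp [Constants.term] at hi
  · simp only [Term.varFinsetLeft, Finset.mem_singleton] at hi
    rw [hi, Term.realize_var, Sum.elim_inl]
  · exact j.elim0

/-- Values over `S` that `p` sends to prescribed values in `M`. -/
def Lifts (p : Fin n → M) (S : Set (Fin n)) (z : Dom M f) (m : M) : Prop :=
  hat L p z.1 = m ∧ Over S z.1

theorem lifts_realize (h : IsSignature L) {S : Set (Fin n)} {p : Fin n → M} {X : Type*}
    [DecidableEq X] (t : L.Term (X ⊕ Fin 0)) {x : X → Dom M f} {y : X → M}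
    (hxy : ∀ i ∈ t.varFinsetLeft, Lifts p S (x i) (y i)) (xs : Fin 0 → Dom M f) (ys : Fin 0 → M) :
    letI := domStructure h M f
    Lifts p S (t.realize (Sum.elim x xs)) (t.realize (Sum.elim y ys)) := by
  let := domStructure h M f
  obtain ⟨c, rfl⟩ | ⟨j | j, rfl⟩ := term_cases h t
  · rw [Term.realize_constants, Term.realize_constants]
    exact ⟨rfl, fun b hb => by cases hb⟩
  · exact hxy j (by simp)
  · exact j.elim0

theorem PIso.realize_iff (h : IsSignature L) (hM : StandardNames L M) {S : Set (Fin n)}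
    {p : Fin n → M} (hp : PIso f S p) {X : Type*} [DecidableEq X] {θ : L.Formula X} (hθ : θ.IsQF)
    {x : X → Dom M f} {y : X → M} (hxy : ∀ i ∈ θ.freeVarFinset, Lifts p S (x i) (y i)) :
    letI := domStructure h M f
    θ.Realize x ↔ θ.Realize y := by
  let := domStructure h M f
  unfold Formula.Realize
  induction hθ with
  | falsum => rfl
  | of_isAtomic ha =>
    cases ha with
    | equal t₁ t₂ =>
      have h₁ := lifts_realize h t₁ (fun i hi => hxy i (Finset.mem_union_left _ hi)) default default
      have h₂ := lifts_realize h t₂ (fun i hi => hxy i (Finset.mem_union_right _ hi))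
        default default
      rw [BoundedFormula.realize_bdEqual, BoundedFormula.realize_bdEqual, ← h₁.1, ← h₂.1]
      exact ⟨fun e => by rw [e], fun e => Subtype.ext (hp.injOn_hat hM h₁.2 h₂.2 e)⟩
    | rel R ts =>
      have hl := fun i => lifts_realize h (ts i)
        (fun j hj => hxy j (Finset.mem_biUnion.2 ⟨i, Finset.mem_univ _, hj⟩)) default default
      rw [BoundedFormula.realize_rel, BoundedFormula.realize_rel,
        hp.relMap_iff h R _ fun i => (hl i).2]
      simp only [(hl _).1]
  | imp _ _ ih₁ ih₂ =>
    rw [BoundedFormula.realize_imp, BoundedFormula.realize_imp]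
    exact imp_congr (ih₁ fun i hi => hxy i (Finset.mem_union_left _ hi))
      (ih₂ fun i hi => hxy i (Finset.mem_union_right _ hi))

/-- The unnamed elements among the values of the variables of a true atom are at most
`width L` many. -/
theorem ncard_unnamed_le (h : IsSignature L) {X : Type*} [DecidableEq X] {α : L.Formula X}
    (hα : α.IsAtomic) {y : X → M} (hy : α.Realize y) :
    {m | m ∈ unnamed L M ∧ ∃ i ∈ α.freeVarFinset, y i = m}.Finite ∧
      {m | m ∈ unnamed L M ∧ ∃ i ∈ α.freeVarFinset, y i = m}.ncard ≤ width L := by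
  unfold Formula.Realize at hy
  cases hα with
  | equal t₁ t₂ =>
    rw [BoundedFormula.realize_bdEqual] at hy
    -- All variables of a true equality share one value, and the width is at least 1.
    have hsub : {m | m ∈ unnamed L M ∧ ∃ i ∈ (t₁.bdEqual t₂).freeVarFinset, y i = m} ⊆
        {t₁.realize (Sum.elim y default)} := by
      rintro m ⟨_, i, hi, rfl⟩
      rcases Finset.mem_union.1 hi with hi | hi
      · exact (realize_eq_of_mem h t₁ hi y default).symm
      · exact (hy.trans (realize_eq_of_mem h t₂ hi y default)).symm
    refine ⟨(Set.finite_singleton _).subset hsub, ?_⟩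
    have := Set.ncard_le_ncard hsub
    rw [Set.ncard_singleton] at this
    exact this.trans (one_le_width h)
  | @rel k R ts =>
    have hsub : {m | m ∈ unnamed L M ∧ ∃ i ∈ (R.boundedFormula ts).freeVarFinset, y i = m} ⊆
        Set.range fun j => (ts j).realize (Sum.elim y default) := by
      rintro m ⟨_, i, hi, rfl⟩
      obtain ⟨j, _, hj⟩ := Finset.mem_biUnion.1 hi
      exact ⟨j, realize_eq_of_mem h (ts j) hj y default⟩
    refine ⟨(Set.finite_range _).subset hsub, (Set.ncard_le_ncard hsub).trans ?_⟩
    rw [← Set.image_univ]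
    refine (Set.ncard_image_le).trans ?_
    simpa using le_width h R

/-- The values of the variables of a true guard in `Dom M f` lie in a part isomorphic to a part of
`M`. -/
theorem Generic.exists_pIso (hf : Generic M f) (h : IsSignature L) [Nonempty M] {X : Type*}
    [DecidableEq X] {α : L.Formula X} (hα : α.IsAtomic) {x : X → Dom M f}
    (hx : letI := domStructure h M f; α.Realize x) :
    ∃ (S : Set (Fin n)) (p : Fin n → M), PIso f S p ∧ ∀ i ∈ α.freeVarFinset, Over S (x i).1 := by
  let := domStructure h M f
  unfold Formula.Realize at hx
  cases hα with
  | equal t₁ t₂ =>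
    rw [BoundedFormula.realize_bdEqual] at hx
    have hval : ∀ i ∈ (t₁.bdEqual t₂).freeVarFinset,
        x i = t₁.realize (Sum.elim x default) := by
      intro i hi
      rcases Finset.mem_union.1 hi with hi | hi
      · exact (realize_eq_of_mem h t₁ hi x default).symm
      · exact (hx.trans (realize_eq_of_mem h t₂ hi x default)).symm
    generalize t₁.realize (Sum.elim x default) = z at hval
    obtain ⟨c | b, hz⟩ := z
    · refine ⟨∅, fun _ => Classical.arbitrary M, hf.pIso_empty _, fun i hi b hb => ?_⟩
      rw [hval i hi] at hb
      cases hb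
    -- An equality guard yields no fact, so the partial isomorphism comes from the restriction of
    -- the domain to realised 1-types.
    · obtain ⟨p, hp⟩ := hz b rfl
      refine ⟨{b}, p, hp, fun i hi b' hb => ?_⟩
      rw [hval i hi] at hb
      exact (Sum.inr_injective hb).symm
  | rel R ts =>
    rw [BoundedFormula.realize_rel] at hx
    obtain ⟨p, hp, _⟩ := hx
    refine ⟨_, p, hp, fun i hi b hb => ?_⟩
    obtain ⟨j, _, hj⟩ := Finset.mem_biUnion.1 hi
    exact ⟨j, (congrArg Subtype.val (realize_eq_of_mem h (ts j) hj x default)).trans hb⟩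

theorem PIso.exists_lifts {S : Set (Fin n)} {p : Fin n → M} (hp : PIso f S p) {m : M}
    (hm : m ∈ unnamed L M → m ∈ p '' S) : ∃ z : Dom M f, Lifts p S z m := by
  by_cases hu : m ∈ unnamed L M
  · obtain ⟨b, hb, rfl⟩ := hm hu
    refine ⟨⟨Sum.inr b, fun b' hb' => ?_⟩, rfl, fun b' hb' => ?_⟩
    · obtain rfl := Sum.inr_injective hb'
      exact ⟨p, hp.mono (Set.singleton_subset_iff.2 hb)⟩
    · obtain rfl := Sum.inr_injective hb'
      exact hb
  · obtain ⟨c, rfl⟩ := not_not.1 hu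
    exact ⟨⟨Sum.inl c, fun b hb => by cases hb⟩, rfl, fun b hb => by cases hb⟩

theorem lifts_hat {S : Set (Fin n)} {p : Fin n → M} {z : Dom M f} (hz : Over S z.1) :
    Lifts p S z (hat L p z.1) := ⟨rfl, hz⟩

/-! ### Preservation of the three kinds of conjuncts -/

theorem realize_existential (h : IsSignature L) (hM : StandardNames L M) [Nonempty M]
    (hf : Generic M f) {k : ℕ} {α ψ : L.Formula (Fin k)} (hα : α.IsAtomic) (hψ : ψ.IsQF)
    (hfv : α.freeVarFinset = Finset.univ) (hφ : ∃ y : Fin k → M, α.Realize y ∧ ψ.Realize y) :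
    letI := domStructure h M f
    ∃ x : Fin k → Dom M f, α.Realize x ∧ ψ.Realize x := by
  obtain ⟨y, hy, hy'⟩ := hφ
  obtain ⟨hfin, hcard⟩ := ncard_unnamed_le h hα hy
  obtain ⟨S, p, -, hp, -, hpS⟩ := PIso.exists_image_eq hf hfin hcard (fun m hm => hm.1) _ ∅
    (fun _ => Classical.arbitrary M) (hf.pIso_empty _) (by simp) (Nat.le_add_left _ _)
  have hl : ∀ i, ∃ z : Dom M f, Lifts p S z (y i) := fun i =>
    hp.exists_lifts fun hu => by
      rw [hpS]
      exact ⟨hu, i, by simp [hfv], rfl⟩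
  choose x hx using hl
  exact ⟨x, (hp.realize_iff h hM (.of_isAtomic hα) fun i _ => hx i).2 hy,
    (hp.realize_iff h hM hψ fun i _ => hx i).2 hy'⟩

theorem realize_universal (h : IsSignature L) (hM : StandardNames L M) [Nonempty M]
    (hf : Generic M f) {k : ℕ} {α ψ : L.Formula (Fin k)} (hα : α.IsAtomic) (hψ : ψ.IsQF)
    (hfv : α.freeVarFinset = Finset.univ) (hφ : ∀ y : Fin k → M, α.Realize y → ψ.Realize y) :
    letI := domStructure h M f
    ∀ x : Fin k → Dom M f, α.Realize x → ψ.Realize x := by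
  intro x hx
  obtain ⟨S, p, hp, hS⟩ := hf.exists_pIso h hα hx
  have hl : ∀ i, Lifts p S (x i) (hat L p (x i).1) := fun i => lifts_hat (hS i (by simp [hfv]))
  exact (hp.realize_iff h hM hψ fun i _ => hl i).2
    (hφ _ ((hp.realize_iff h hM (.of_isAtomic hα) fun i _ => hl i).1 hx))

theorem realize_skolem (h : IsSignature L) (hM : StandardNames L M) [Nonempty M]
    (hf : Generic M f) {k m : ℕ} {α : L.Formula (Fin k)} {β ψ : L.Formula (Fin k ⊕ Fin m)}
    (hα : α.IsAtomic) (hβ : β.IsAtomic) (hψ : ψ.IsQF) (hfv : α.freeVarFinset = Finset.univ)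
    (hβy : ∀ j : Fin m, Sum.inr j ∈ β.freeVarFinset)
    (hψβ : ψ.freeVarFinset ⊆ β.freeVarFinset)
    (hφ : ∀ y : Fin k → M, α.Realize y →
      ∃ y' : Fin m → M, β.Realize (Sum.elim y y') ∧ ψ.Realize (Sum.elim y y')) :
    letI := domStructure h M f
    ∀ x : Fin k → Dom M f, α.Realize x →
      ∃ x' : Fin m → Dom M f, β.Realize (Sum.elim x x') ∧ ψ.Realize (Sum.elim x x') := by
  intro x hx
  obtain ⟨S, p, hp, hS⟩ := hf.exists_pIso h hα hx
  have hl : ∀ i, Lifts p S (x i) (hat L p (x i).1) := fun i => lifts_hat (hS i (by simp [hfv]))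
  obtain ⟨y', hy₁, hy₂⟩ := hφ _ ((hp.realize_iff h hM (.of_isAtomic hα) fun i _ => hl i).1 hx)
  obtain ⟨hfin, hcard⟩ := ncard_unnamed_le h hβ hy₁
  set Y := {a | a ∈ unnamed L M ∧ ∃ i ∈ β.freeVarFinset,
    Sum.elim (fun i => hat L p (x i).1) y' i = a} with hY
  -- `β` may omit variables of x̄, and keeping their vertices could exceed the width. So the partial
  -- isomorphism is first restricted to vertices whose image occurs in `β`; this suffices as `ψ` has
  -- no other variables.
  obtain ⟨S', p', hSS', hp', heq, him⟩ := PIso.exists_image_eq hf hfin hcard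
    (fun _ hm => hm.1) _ {s ∈ S | p s ∈ Y} p (hp.mono (Set.sep_subset _ _))
    (by rintro _ ⟨s, hs, rfl⟩; exact hs.2) (Nat.le_add_left _ _)
  have hl' : ∀ j, ∃ z : Dom M f, Lifts p' S' z (y' j) := fun j =>
    hp'.exists_lifts fun hu => by
      rw [him]
      exact ⟨hu, Sum.inr j, hβy j, rfl⟩
  choose x' hx' using hl'
  have hall : ∀ i ∈ β.freeVarFinset,
      Lifts p' S' (Sum.elim x x' i) (Sum.elim (fun i => hat L p (x i).1) y' i) := by
    rintro (i | j) hi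
    · have hov : Over {s ∈ S | p s ∈ Y} (x i).1 := fun b hb => by
        have hbS := (hl i).2 b hb
        refine ⟨hbS, hp.mapsTo hbS, Sum.inl i, hi, ?_⟩
        rw [Sum.elim_inl, hb]
        rfl
      exact ⟨(hat_congr heq hov).symm, hov.mono hSS'⟩
    · exact hx' j
  exact ⟨x', (hp'.realize_iff h hM (.of_isAtomic hβ) hall).2 hy₁,
    (hp'.realize_iff h hM hψ fun i hi => hall i (hψβ hi)).2 hy₂⟩

theorem realize_iExs_sentence {N : Type*} [L.Structure N] {k : ℕ} (θ : L.Formula (Fin k)) :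
    (N ⊨ (Formula.iExs (Fin k) (Formula.relabel Sum.inr θ) : L.Sentence)) ↔
      ∃ x : Fin k → N, θ.Realize x := by
  simp [Sentence.Realize, Formula.realize_iExs, Formula.realize_relabel]

theorem realize_iAlls_sentence {N : Type*} [L.Structure N] {k : ℕ} (θ : L.Formula (Fin k)) :
    (N ⊨ (Formula.iAlls (Fin k) (Formula.relabel Sum.inr θ) : L.Sentence)) ↔
      ∀ x : Fin k → N, θ.Realize x := by
  simp [Sentence.Realize, Formula.realize_iAlls, Formula.realize_relabel, Function.comp_def]

theorem IsNormalForm.realize_dom (h : IsSignature L) (hM : StandardNames L M) [Nonempty M]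
    (hf : Generic M f) {φ : L.Sentence} (hφ : IsNormalForm φ) (hMφ : M ⊨ φ) :
    letI := domStructure h M f
    Dom M f ⊨ φ := by
  let := domStructure h M f
  induction hφ with
  | top => exact BoundedFormula.realize_top.2 trivial
  | and φ₁ φ₂ _ _ ih₁ ih₂ =>
    have := Formula.realize_inf.1 hMφ
    exact Formula.realize_inf.2 ⟨ih₁ this.1, ih₂ this.2⟩
  | existential k α ψ hα hψ hfv =>
    rw [realize_iExs_sentence] at hMφ ⊢
    simp only [Formula.realize_inf] at hMφ ⊢
    exact realize_existential h hM hf hα hψ hfv hMφ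
  | universal k α ψ hα hψ hfv =>
    rw [realize_iAlls_sentence] at hMφ ⊢
    simp only [Formula.realize_imp] at hMφ ⊢
    exact realize_universal h hM hf hα hψ hfv hMφ
  | skolem k m α β ψ hα hβ hψ hfv hβy hψβ =>
    rw [realize_iAlls_sentence] at hMφ ⊢
    simp only [Formula.realize_imp, Formula.realize_iExs, Formula.realize_inf] at hMφ ⊢
    exact realize_skolem h hM hf hα hβ hψ hfv hβy hψβ hMφ

/-! ### Remaining properties of the model and conclusion -/

/-- Without constants, a vertex is obtained by extending the empty partial isomorphism to an element
of M. -/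
theorem nonempty_dom (h : IsSignature L) [Nonempty M] (hf : Generic M f) : Nonempty (Dom M f) := by
  let m : M := Classical.arbitrary M
  by_cases hm : m ∈ unnamed L M
  · obtain ⟨b, -, hb⟩ := (hf.pIso_empty fun _ => m).exists_insert hf
      (by rw [Set.ncard_empty]; exact one_le_width h) hm (by simp)
    refine ⟨⟨Sum.inr b, fun b' hb' => ?_⟩⟩
    obtain rfl := Sum.inr_injective hb'
    exact ⟨_, hb.mono (by simp)⟩
  · obtain ⟨c, -⟩ := not_not.1 hm
    exact ⟨⟨Sum.inl c, fun b hb => by cases hb⟩⟩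

theorem standardNames_dom (h : IsSignature L) :
    letI := domStructure h M f
    StandardNames L (Dom M f) := fun _ _ hc => Sum.inl_injective (congrArg Subtype.val hc)

theorem ncard_unnamed_dom_le (h : IsSignature L) :
    letI := domStructure h M f
    (unnamed L (Dom M f)).ncard ≤ n := by
  let := domStructure h M f
  have hsub : Subtype.val '' unnamed L (Dom M f) ⊆ Set.range (Sum.inr : Fin n → _) := by
    rintro _ ⟨⟨c | b, hx⟩, hu, rfl⟩
    · exact (hu ⟨c, Subtype.ext rfl⟩).elim
    · exact ⟨b, rfl⟩
  have h1 := Set.ncard_le_ncard hsub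
  rw [Set.ncard_image_of_injective _ Subtype.val_injective, ← Set.image_univ,
    Set.ncard_image_of_injective _ Sum.inr_injective] at h1
  simpa using h1

/-- A finite structure can be moved to the smallest universe. -/
theorem exists_small_copy (N : Type*) [L.Structure N] [Finite N] :
    ∃ (N' : Type) (_ : L.Structure N'), Nonempty (N ≃[L] N') := by
  obtain ⟨k, ⟨e⟩⟩ := Finite.exists_equiv_fin N
  exact ⟨Fin k, e.inducedStructure, ⟨e.inducedStructureEquiv⟩⟩

theorem unnamed_equiv {N N' : Type*} [L.Structure N] [L.Structure N'] (e : N ≃[L] N') :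
    unnamed L N' = e '' unnamed L N := by
  ext x
  obtain ⟨y, rfl⟩ := e.surjective x
  rw [e.injective.mem_set_image]
  simp only [unnamed, Set.mem_compl_iff, Set.mem_range, not_iff_not]
  refine exists_congr fun c => ?_
  rw [← e.map_constants c, e.injective.eq_iff]

end Generic

end GuardedFragment

theorem mainTheorem6 :
    ∃ C : ℝ, 0 < C ∧
      ∀ L : FirstOrder.Language.{u, v}, GuardedFragment.IsSignature L →
      ∀ φ : L.Sentence, GuardedFragment.IsNormalForm φ →
      (∃ (M : Type w) (_ : L.Structure M),
        Nonempty M ∧ GuardedFragment.StandardNames L M ∧ M ⊨ φ) →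
      ∃ (N : Type) (_ : L.Structure N),
        Nonempty N ∧ GuardedFragment.StandardNames L N ∧ N ⊨ φ ∧ Finite N ∧
        ((GuardedFragment.unnamed L N).ncard : ℝ) ≤
          C * (((GuardedFragment.kTypes L (GuardedFragment.width L)).ncard : ℝ) /
              ((GuardedFragment.kTypes L (GuardedFragment.width L - 1)).ncard : ℝ)) *
            Real.log ((GuardedFragment.kTypes L (GuardedFragment.width L)).ncard : ℝ) ^ 2 := by
  refine ⟨16 / Real.log 2 ^ 2, div_pos (by norm_num) (pow_pos (Real.log_pos one_lt_two) 2), ?_⟩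
  rintro L h φ hφ ⟨M, _, hne, hM, hMφ⟩
  obtain ⟨f, hf⟩ := GuardedFragment.exists_generic h M
  let := GuardedFragment.domStructure h M f
  have := h.finite_constants
  have hfin : Finite (GuardedFragment.Dom M f) := Subtype.finite
  have hdom := GuardedFragment.nonempty_dom h hf
  obtain ⟨N, _, ⟨e⟩⟩ := GuardedFragment.exists_small_copy (L := L) (GuardedFragment.Dom M f)
  refine ⟨N, inferInstance, hdom.map e, fun c c' hc => ?_,
    (FirstOrder.Language.StrongHomClass.realize_sentence e φ).1 (hφ.realize_dom h hM hf hMφ),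
    Finite.of_equiv _ e.toEquiv, ?_⟩
  · refine GuardedFragment.standardNames_dom h (e.injective ?_)
    simpa only [e.map_constants] using hc
  · rw [← GuardedFragment.size_eq h, GuardedFragment.unnamed_equiv e,
      Set.ncard_image_of_injective _ e.injective]
    exact_mod_cast GuardedFragment.ncard_unnamed_dom_le h
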